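/- Let $n,k\ge 0$ be integers. A set partition $\pi$ of $\{1,\dots,n\}$ is drawn by placing $1,\dots,n$ on a line, joining any two consecutive elements $b_1<b_2$, $b_2<b_3$, $\dots$ of each block $\{b_1<b_2<\dots<b_l\}$ by an arc, and adding, for the maximal element $m$ of every block (including singletons), an infinite arc starting at $m$ and extending to the right. Let $\mathrm{cro}^*(\pi)$ be the number of crossings in this drawing, that is, the number of pairs of arcs $(i,j)$, $(k',l)$ with $i<k'<j<l$, where $j$ and $l$ may be $\infty$ (so two infinite arcs do not cross), and let $|\pi|$ be the number of blocks of $\pi$. Put $[m]_q=1+q+\dots+q^{m-1}$ and $\binom{m}{r}_q=\prod_{i=1}^{r}\frac{[m-r+i]_q}{[i]_q}$. Let $q$ be an indeterminate or, more generally, an element of a field $K$ such that $q^i\ne 1$ for $1\le i\le n$ (so that no denominator below vanishes). Then $$\sum_{\substack{\pi \text{ set partition of } \{1,\dots,n\}\\ |\pi|=k}} q^{\mathrm{cro}^*(\pi)} \;=\; \frac{1}{(1-q)^{n-k}}\sum_{j=0}^{n-k}(-1)^j\binom{n}{k+j}\binom{k+j}{j}_q ,$$ where for $k>n$ both sums are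 empty. -/

import Mathlib

/-- The `q`-integer `[n]_q = 1 + q + ⋯ + q^(n-1)`. -/
def qInt {K : Type*} [Field K] (q : K) (n : ℕ) : K :=
  ∑ i ∈ Finset.range n, q ^ i

/-- The `q`-binomial coefficient `∏_{i=1}^{k} [n-k+i]_q / [i]_q`. The index is written `n + i - k`
so that truncated subtraction still gives a factor `[0]_q = 0` (hence the value `0`) if `k > n`. -/
def qBinom {K : Type*} [Field K] (q : K) (n k : ℕ) : K :=
  ∏ i ∈ Finset.Icc 1 k, qInt q (n + i - k) / qInt q i

namespace SetPartition

/-- The (finite) arcs of a set partition of `{1, …, n}`: pairs `(i, j)`, `i < j`, of consecutive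
elements of a block. -/
def arcs {n : ℕ} (π : Finpartition (Finset.Icc 1 n)) : Finset (ℕ × ℕ) :=
  (Finset.Icc 1 n ×ˢ Finset.Icc 1 n).filter fun a =>
    ∃ B ∈ π.parts, a.1 ∈ B ∧ a.2 ∈ B ∧ a.1 < a.2 ∧ ∀ x ∈ B, ¬ (a.1 < x ∧ x < a.2)

/-- The maximal elements of the blocks of a set partition of `{1, …, n}`. -/
def blockMaxima {n : ℕ} (π : Finpartition (Finset.Icc 1 n)) : Finset ℕ :=
  (Finset.Icc 1 n).filter fun m => ∃ B ∈ π.parts, m ∈ B ∧ ∀ x ∈ B, x ≤ m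

/-- All arcs of the drawing with infinite arcs: the finite arcs, and for every block maximum `m`
(singletons included) an infinite arc `(m, ⊤)` that extends to the right. -/
def arcsStar {n : ℕ} (π : Finpartition (Finset.Icc 1 n)) : Finset (ℕ × WithTop ℕ) :=
  ((arcs π).image fun a => (a.1, (a.2 : WithTop ℕ))) ∪
    ((blockMaxima π).image fun m => (m, (⊤ : WithTop ℕ)))

/-- The number of crossings in the drawing with infinite arcs: pairs of arcs `(i, j)`, `(k, l)`
with `i < k < j < l`. As `⊤ < ⊤` is false, two infinite arcs never cross. -/
def croStar {n : ℕ} (π : Finpartition (Finset.Icc 1 n)) : ℕ :=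
  ((arcsStar π ×ˢ arcsStar π).filter fun p =>
    p.1.1 < p.2.1 ∧ (p.2.1 : WithTop ℕ) < p.1.2 ∧ p.1.2 < p.2.2).card

end SetPartition

/-! Both sides, after clearing `(1 - q) ^ (n - k)`, obey the same recurrence in `n`.

On partitions, remove `n + 1` (`addTop_bijective`). As a singleton it creates no crossing. If it
joins a block with maximum `m`, the infinite arc at `m` becomes the arc `(m, n + 1)`: it keeps its
crossings with the finite arcs over `m` and gains one with each infinite arc starting right of `m`
(`croStar_addTop`). Over the `k` blocks the gains are `0, …, k - 1`, whence the Stirling-type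
recurrence S(n+1, k) = S(n, k-1) + [k]_q S(n, k).

On the alternating sum, Pascal's rule for the ordinary binomial and the `q`-Pascal rule yield the
same recurrence with `1 - q ^ k` for [k]_q (`altSum_succ_succ`); the two differ by the factor `1 -
q`. -/

/-- The Gaussian binomial coefficient of `k + j` and `j`, by the `q`-Pascal rule. -/
def gaussBinom {K : Type*} [Field K] (q : K) : ℕ → ℕ → K
  | _, 0 => 1
  | 0, _ + 1 => 1
  | k + 1, j + 1 => gaussBinom q k (j + 1) + q ^ (k + 1) * gaussBinom q (k + 1) j

/-! ### Gaussian binomials and the alternating sum. -/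

section QAnalogues

variable {K : Type*} [Field K] (q : K)

lemma gaussBinom_zero_right (k : ℕ) : gaussBinom q k 0 = 1 := by
  cases k <;> simp [gaussBinom]

lemma gaussBinom_zero_left (j : ℕ) : gaussBinom q 0 j = 1 := by
  cases j <;> simp [gaussBinom]

lemma qInt_add (m n : ℕ) : qInt q (m + n) = qInt q m + q ^ m * qInt q n := by
  simp [qInt, Finset.sum_range_add, Finset.mul_sum, pow_add]

lemma one_sub_mul_qInt (n : ℕ) : (1 - q) * qInt q n = 1 - q ^ n :=
  mul_neg_geom_sum q n

lemma qInt_ne_zero {n : ℕ} (h : q ^ n ≠ 1) : qInt q n ≠ 0 := by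
  intro h0
  have := one_sub_mul_qInt q n
  rw [h0, mul_zero] at this
  exact h (sub_eq_zero.mp this.symm).symm

lemma prod_qInt_shift (k j : ℕ) :
    qInt q (k + 1) * ∏ i ∈ Finset.range j, qInt q (k + 1 + (i + 1)) =
      ∏ i ∈ Finset.range (j + 1), qInt q (k + (i + 1)) := by
  rw [Finset.prod_range_succ', mul_comm]
  congr 1
  exact Finset.prod_congr rfl fun i _ => by congr 1; ring

/-- The product formula with denominators cleared, so that it holds for every `q`. The splitting
[k+j+2] = [k+1] + q^(k+1) [j+1] matches the two terms of the `q`-Pascal rule. -/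
lemma gaussBinom_mul_prod_qInt (k j : ℕ) :
    gaussBinom q k j * ∏ i ∈ Finset.range j, qInt q (i + 1) =
      ∏ i ∈ Finset.range j, qInt q (k + (i + 1)) := by
  induction k generalizing j with
  | zero => simp [gaussBinom_zero_left]
  | succ k ihk =>
    induction j with
    | zero => simp [gaussBinom_zero_right]
    | succ j ihj =>
      have h := ihk (j + 1)
      rw [← prod_qInt_shift] at h
      rw [gaussBinom, add_mul, h, Finset.prod_range_succ _ j, Finset.prod_range_succ _ j,
        show k + 1 + (j + 1) = (k + 1) + (j + 1) by rfl, qInt_add q (k + 1) (j + 1)]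
      linear_combination q ^ (k + 1) * qInt q (j + 1) * ihj

lemma qBinom_eq_gaussBinom {k j : ℕ} (h : ∀ i, 1 ≤ i → i ≤ j → q ^ i ≠ 1) :
    qBinom q (k + j) j = gaussBinom q k j := by
  have hne : ∏ i ∈ Finset.range j, qInt q (i + 1) ≠ 0 :=
    Finset.prod_ne_zero_iff.mpr fun i hi =>
      qInt_ne_zero q (h _ (by omega) (by have := Finset.mem_range.mp hi; omega))
  rw [qBinom, Finset.prod_div_distrib, ← Finset.Ico_add_one_right_eq_Icc,
    Finset.prod_Ico_eq_prod_range, Finset.prod_Ico_eq_prod_range]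
  simp only [Nat.add_sub_cancel]
  rw [div_eq_iff (by simpa only [add_comm 1] using hne)]
  simp only [add_comm 1]
  rw [gaussBinom_mul_prod_qInt]
  exact Finset.prod_congr rfl fun i _ => by congr 1; omega

/-- The alternating sum `∑ j, (-1)^j (n choose k + j) [k + j choose j]_q`. -/
def altSum (n k : ℕ) : K :=
  ∑ j ∈ Finset.range (n + 1), (-1) ^ j * (n.choose (k + j) : K) * gaussBinom q k j

/-- Terms with `k + j > n` vanish, so the length of the range can be adjusted freely when sums are
compared. -/
lemma altSum_eq_of_le {n k N : ℕ} (h : n < k + N) :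
    altSum q n k =
      ∑ j ∈ Finset.range N, (-1) ^ j * (n.choose (k + j) : K) * gaussBinom q k j := by
  have key : ∀ M, n < k + M → ∀ M', M ≤ M' →
      ∑ j ∈ Finset.range M, (-1) ^ j * (n.choose (k + j) : K) * gaussBinom q k j =
        ∑ j ∈ Finset.range M', (-1) ^ j * (n.choose (k + j) : K) * gaussBinom q k j := by
    intro M hM M' hMM
    refine Finset.sum_subset (Finset.range_mono hMM) fun j _ hj => ?_
    rw [Nat.choose_eq_zero_of_lt (by rw [Finset.mem_range] at hj; omega)]
    simp
  rcases le_total (n + 1) N with hN | hN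
  · exact key _ (by omega) _ hN
  · exact (key _ h _ hN).symm

lemma altSum_succ_zero (n : ℕ) : altSum q (n + 1) 0 = 0 := by
  simp only [altSum, gaussBinom_zero_left, mul_one, zero_add]
  have := congrArg (Int.cast : ℤ → K) (Int.alternating_sum_range_choose (n := n + 1))
  simpa using this

/-- Pascal's rule splits each term in two; in the part with `n.choose (k + j)` the `q`-Pascal rule
splits again, and its second piece is a shifted term of `altSum q n (k + 1)` with opposite sign. -/
lemma altSum_succ_succ (n k : ℕ) :
    altSum q (n + 1) (k + 1) = altSum q n k + (1 - q ^ (k + 1)) * altSum q n (k + 1) := by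
  rw [altSum_eq_of_le q (n := n) (k := k) (N := n + 2) (by omega), altSum,
    sub_mul, one_mul]
  -- Only the first copy is lengthened: the copy multiplied by `q ^ (k + 1)` keeps `n + 1` terms, to
  -- match the shifted index once the `j = 0` terms are split off.
  nth_rw 1 [altSum_eq_of_le q (n := n) (k := k + 1) (N := n + 2) (by omega)]
  rw [altSum, Finset.mul_sum, Finset.sum_range_succ' _ (n + 1), Finset.sum_range_succ' _ (n + 1),
    Finset.sum_range_succ' _ (n + 1)]
  have e : ∀ j, (-1 : K) ^ (j + 1) * ((n + 1).choose (k + 1 + (j + 1)) : K) *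
        gaussBinom q (k + 1) (j + 1) =
      (-1) ^ (j + 1) * (n.choose (k + (j + 1)) : K) * gaussBinom q k (j + 1) +
      ((-1) ^ (j + 1) * (n.choose (k + 1 + (j + 1)) : K) * gaussBinom q (k + 1) (j + 1) -
      q ^ (k + 1) * ((-1) ^ j * (n.choose (k + 1 + j) : K) * gaussBinom q (k + 1) j)) := by
    intro j
    rw [show k + 1 + (j + 1) = (k + 1 + j) + 1 by ring, Nat.choose_succ_succ,
      show k + (j + 1) = k + 1 + j by ring]
    simp only [gaussBinom]
    push_cast
    ring
  simp only [e, Finset.sum_add_distrib, Finset.sum_sub_distrib, gaussBinom_zero_right,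
    Nat.choose_succ_succ, add_zero]
  push_cast
  ring

end QAnalogues

/-- The number of larger elements takes each value `0, …, |S| - 1` exactly once; the minimum
contributes the top exponent. -/
lemma sum_pow_card_filter_gt {R : Type*} [Semiring R] (q : R) (S : Finset ℕ) :
    ∑ m ∈ S, q ^ (S.filter fun x => m < x).card = ∑ i ∈ Finset.range S.card, q ^ i := by
  induction S using Finset.induction_on_min with
  | empty => simp
  | insert a s ha ih =>
    have has : a ∉ s := fun h => lt_irrefl _ (ha a h)
    rw [Finset.sum_insert has, Finset.card_insert_of_notMem has, Finset.sum_range_succ, ← ih,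
      add_comm]
    congr 1
    · refine Finset.sum_congr rfl fun m hm => ?_
      rw [Finset.filter_insert, if_neg (ha m hm).not_gt]
    · rw [Finset.filter_insert, if_neg (lt_irrefl a), Finset.filter_true_of_mem ha]

/-! ### Building partitions of `{1, …, n + 1}` from those of `{1, …, n}`. -/

namespace SetPartition

/-- Adjoin `n + 1` to the block `B` of a partition of `{1, …, n}`, or, if `B = ∅`, as a new
singleton block. -/
def addTop {n : ℕ} (π : Finpartition (Finset.Icc 1 n)) (B : Finset ℕ)
    (hB : B ∈ insert ∅ π.parts) : Finpartition (Finset.Icc 1 (n + 1)) :=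
  Finpartition.ofExistsUnique (insert (insert (n + 1) B) (π.parts.erase B))
    (by
      have hsub : ∀ C ∈ π.parts, C ⊆ Finset.Icc 1 (n + 1) := fun C hC =>
        (π.le hC).trans (Finset.Icc_subset_Icc_right (Nat.le_succ n))
      intro C hC
      rcases Finset.mem_insert.mp hC with rfl | hC
      · refine Finset.insert_subset (by simp) ?_
        rcases Finset.mem_insert.mp hB with rfl | hB
        · simp
        · exact hsub B hB
      · exact hsub C (Finset.mem_of_mem_erase hC))
    (by
      have htop : ∀ C ∈ π.parts, n + 1 ∉ C := fun C hC h => by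
        have := Finset.mem_Icc.mp (π.le hC h)
        omega
      intro a ha
      by_cases haB : a ∈ insert (n + 1) B
      · refine ⟨insert (n + 1) B, ⟨Finset.mem_insert_self _ _, haB⟩, ?_⟩
        rintro C ⟨hC, haC⟩
        rcases Finset.mem_insert.mp hC with rfl | hC
        · rfl
        · obtain ⟨hne, hC⟩ := Finset.mem_erase.mp hC
          rcases Finset.mem_insert.mp haB with rfl | haB
          · exact absurd haC (htop C hC)
          · rcases Finset.mem_insert.mp hB with rfl | hB
            · simp at haB
            · exact absurd (π.eq_of_mem_parts hC hB haC haB) hne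
      · have haB' := haB
        rw [Finset.mem_insert, not_or] at haB
        have ha' : a ∈ Finset.Icc 1 n := by
          rw [Finset.mem_Icc] at ha ⊢
          omega
        obtain ⟨C, hC, haC⟩ := π.exists_mem ha'
        refine ⟨C, ⟨Finset.mem_insert_of_mem (Finset.mem_erase.mpr
          ⟨fun h => haB.2 (h ▸ haC), hC⟩), haC⟩, ?_⟩
        rintro D ⟨hD, haD⟩
        rcases Finset.mem_insert.mp hD with rfl | hD
        · exact absurd haD haB'
        · exact π.eq_of_mem_parts (Finset.mem_of_mem_erase hD) hC haD haC)
    (by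
      intro h
      rcases Finset.mem_insert.mp h with h | h
      · exact Finset.insert_ne_empty _ _ h.symm
      · exact π.empty_notMem_parts (Finset.mem_of_mem_erase h))

section AddTop

variable {n : ℕ} (π : Finpartition (Finset.Icc 1 n)) (B : Finset ℕ) (hB : B ∈ insert ∅ π.parts)

lemma addTop_parts :
    (addTop π B hB).parts = insert (insert (n + 1) B) (π.parts.erase B) := rfl

variable {π B}

lemma top_notMem {C : Finset ℕ} (hC : C ∈ π.parts) : n + 1 ∉ C := fun h => by
  have := Finset.mem_Icc.mp (π.le hC h)
  omega

lemma top_notMem_of_mem_insert (hB : B ∈ insert ∅ π.parts) : n + 1 ∉ B := by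
  rcases Finset.mem_insert.mp hB with rfl | hB
  · simp
  · exact top_notMem hB

lemma insert_top_notMem_erase : insert (n + 1) B ∉ π.parts.erase B := fun h =>
  top_notMem (Finset.mem_of_mem_erase h) (Finset.mem_insert_self _ _)

lemma card_addTop_parts_of_mem (hB' : B ∈ π.parts) :
    (addTop π B hB).parts.card = π.parts.card := by
  rw [addTop_parts, Finset.card_insert_of_notMem insert_top_notMem_erase,
    Finset.card_erase_add_one hB']

variable (π) in
lemma card_addTop_empty_parts (h : ∅ ∈ insert ∅ π.parts) :
    (addTop π ∅ h).parts.card = π.parts.card + 1 := by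
  rw [addTop_parts, Finset.card_insert_of_notMem insert_top_notMem_erase,
    Finset.erase_eq_of_notMem π.empty_notMem_parts]

end AddTop

/-- The inverse deletes `n + 1` from its block `T`; the chosen `B` is what remains of `T`, empty
when `n + 1` was a singleton. -/
lemma addTop_bijective (n : ℕ) :
    Function.Bijective fun x : (Σ π : Finpartition (Finset.Icc 1 n),
      {B : Finset ℕ // B ∈ insert ∅ π.parts}) => addTop x.1 x.2.1 x.2.2 := by
  constructor
  · rintro ⟨π, B, hB⟩ ⟨σ, C, hC⟩ h
    have hp : insert (insert (n + 1) B) (π.parts.erase B) =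
        insert (insert (n + 1) C) (σ.parts.erase C) := congrArg Finpartition.parts h
    have hins : insert (n + 1) B = insert (n + 1) C :=
      Finpartition.eq_of_mem_parts (addTop π B hB)
        (Finset.mem_insert_self _ _) (by
          rw [addTop_parts, hp]
          exact Finset.mem_insert_self _ _) (Finset.mem_insert_self (n + 1) B)
        (Finset.mem_insert_self _ _)
    have hBC : B = C := by
      rw [← Finset.erase_insert (top_notMem_of_mem_insert hB), hins,
        Finset.erase_insert (top_notMem_of_mem_insert hC)]
    subst hBC
    have he : π.parts.erase B = σ.parts.erase B := by
      rw [← Finset.erase_insert (insert_top_notMem_erase (π := π) (B := B)), hp,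
        Finset.erase_insert (insert_top_notMem_erase (π := σ) (B := B))]
    have hπσ : π = σ := by
      apply Finpartition.ext
      rcases Finset.mem_insert.mp hB with rfl | hB
      · rwa [Finset.erase_eq_of_notMem π.empty_notMem_parts,
          Finset.erase_eq_of_notMem σ.empty_notMem_parts] at he
      · have hC' : B ∈ σ.parts := (Finset.mem_insert.mp hC).resolve_left fun h0 =>
          π.empty_notMem_parts (h0 ▸ hB)
        rw [← Finset.insert_erase hB, he, Finset.insert_erase hC']
    subst hπσ
    rfl
  · intro ρ
    have htop : n + 1 ∈ Finset.Icc 1 (n + 1) := by simp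
    set T := ρ.part (n + 1) with hT
    have hTmem : T ∈ ρ.parts := ρ.part_mem.mpr htop
    have hTtop : n + 1 ∈ T := ρ.mem_part htop
    have hsub : ∀ C ∈ ρ.parts, n + 1 ∉ C → C ⊆ Finset.Icc 1 n := by
      intro C hC h a ha
      have h1 := Finset.mem_Icc.mp (ρ.le hC ha)
      have h2 : a ≠ n + 1 := fun h' => h (h' ▸ ha)
      rw [Finset.mem_Icc]
      omega
    have hother : ∀ C ∈ ρ.parts, C ≠ T → n + 1 ∉ C := fun C hC hne h =>
      hne (ρ.eq_of_mem_parts hC hTmem h hTtop)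
    -- Erasing `∅` covers the case `T = {n + 1}`, where nothing of `T` survives.
    let P : Finset (Finset ℕ) := (insert (T.erase (n + 1)) (ρ.parts.erase T)).erase ∅
    have hP : ∀ C, C ∈ P ↔ C ≠ ∅ ∧ (C = T.erase (n + 1) ∨ (C ≠ T ∧ C ∈ ρ.parts)) := by
      intro C
      simp [P]
    let π : Finpartition (Finset.Icc 1 n) := Finpartition.ofExistsUnique P
      (by
        intro C hC
        rcases (hP C).mp hC with ⟨-, rfl | ⟨h1, h2⟩⟩
        · intro a ha
          obtain ⟨h1, h2⟩ := Finset.mem_erase.mp ha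
          have h3 := Finset.mem_Icc.mp (ρ.le hTmem h2)
          rw [Finset.mem_Icc]
          omega
        · exact hsub C h2 (hother C h2 h1))
      (by
        intro a ha
        have ha1 := Finset.mem_Icc.mp ha
        have hane : a ≠ n + 1 := by omega
        obtain ⟨C, hC, haC⟩ := ρ.exists_mem (a := a) (by rw [Finset.mem_Icc]; omega)
        by_cases hCT : C = T
        · subst hCT
          have haT : a ∈ T.erase (n + 1) := Finset.mem_erase.mpr ⟨hane, haC⟩
          refine ⟨T.erase (n + 1), ⟨(hP _).mpr ⟨Finset.ne_empty_of_mem haT, Or.inl rfl⟩, haT⟩, ?_⟩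
          rintro D ⟨hD, haD⟩
          rcases (hP D).mp hD with ⟨-, h | ⟨h1, h2⟩⟩
          · exact h
          · exact absurd (ρ.eq_of_mem_parts h2 hC haD haC) h1
        · refine ⟨C, ⟨(hP _).mpr ⟨Finset.ne_empty_of_mem haC, Or.inr ⟨hCT, hC⟩⟩, haC⟩, ?_⟩
          rintro D ⟨hD, haD⟩
          rcases (hP D).mp hD with ⟨-, rfl | ⟨h1, h2⟩⟩
          · exact absurd (ρ.eq_of_mem_parts hC hTmem haC (Finset.mem_of_mem_erase haD)) hCT
          · exact ρ.eq_of_mem_parts h2 hC haD haC)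
      (Finset.notMem_erase _ _)
    have hB : T.erase (n + 1) ∈ insert ∅ π.parts := by
      by_cases h : T.erase (n + 1) = ∅
      · rw [h]
        exact Finset.mem_insert_self _ _
      · exact Finset.mem_insert_of_mem ((hP _).mpr ⟨h, Or.inl rfl⟩)
    refine ⟨⟨π, T.erase (n + 1), hB⟩, Finpartition.ext ?_⟩
    ext C
    change C ∈ insert (insert (n + 1) (T.erase (n + 1))) (P.erase (T.erase (n + 1))) ↔ _
    rw [Finset.insert_erase hTtop, Finset.mem_insert, Finset.mem_erase, hP]
    constructor
    · rintro (rfl | ⟨h1, h2, h3 | h3⟩)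
      · exact hTmem
      · exact absurd h3 h1
      · exact h3.2
    · intro hC
      by_cases hCT : C = T
      · exact Or.inl hCT
      · refine Or.inr ⟨?_, ρ.ne_empty hC, Or.inr ⟨hCT, hC⟩⟩
        rintro rfl
        obtain ⟨a, ha⟩ := ρ.nonempty_of_mem_parts hC
        exact hCT (ρ.eq_of_mem_parts hC hTmem ha (Finset.mem_of_mem_erase ha))

lemma sum_finpartition_succ {R : Type*} [AddCommMonoid R] {n : ℕ}
    (f : Finpartition (Finset.Icc 1 (n + 1)) → R)
    (g : Finpartition (Finset.Icc 1 n) → Finset ℕ → R)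
    (h : ∀ π B hB, f (addTop π B hB) = g π B) :
    ∑ ρ, f ρ = ∑ π : Finpartition (Finset.Icc 1 n), (g π ∅ + ∑ B ∈ π.parts, g π B) := by
  rw [← (addTop_bijective n).sum_comp f, Fintype.sum_sigma]
  refine Finset.sum_congr rfl fun π _ => ?_
  rw [← Finset.sum_insert π.empty_notMem_parts]
  refine Eq.trans ?_ (Finset.sum_coe_sort (insert ∅ π.parts) (g π))
  apply Fintype.sum_congr
  rintro ⟨B, hB⟩
  exact h π B hB

/-! ### Arcs and crossings when `n + 1` is adjoined. -/

/-- The finite arcs together with the starting points of the infinite arcs determine the number of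
crossings. -/
lemma croStar_eq_sum {n : ℕ} (π : Finpartition (Finset.Icc 1 n)) :
    croStar π =
      (∑ a ∈ arcs π, ∑ b ∈ arcs π, if a.1 < b.1 ∧ b.1 < a.2 ∧ a.2 < b.2 then 1 else 0) +
      ∑ a ∈ arcs π, ∑ m ∈ blockMaxima π, if a.1 < m ∧ m < a.2 then 1 else 0 := by
  have hdisj : Disjoint ((arcs π).image fun a => (a.1, (a.2 : WithTop ℕ)))
      ((blockMaxima π).image fun m => (m, (⊤ : WithTop ℕ))) := by
    rw [Finset.disjoint_left]
    intro x hx hx'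
    obtain ⟨a, -, rfl⟩ := Finset.mem_image.mp hx
    obtain ⟨m, -, hm⟩ := Finset.mem_image.mp hx'
    simp at hm
  have h1 : Set.InjOn (fun a : ℕ × ℕ => (a.1, (a.2 : WithTop ℕ))) (arcs π) := by
    rintro ⟨a, b⟩ - ⟨c, d⟩ - h
    simpa using h
  have h2 : Set.InjOn (fun m : ℕ => (m, (⊤ : WithTop ℕ))) (blockMaxima π) := by
    intro a _ b _ h
    simpa using h
  rw [croStar, Finset.card_filter, Finset.sum_product, arcsStar, Finset.sum_union hdisj,
    Finset.sum_image h1, Finset.sum_image h2]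
  simp only [Finset.sum_union hdisj, Finset.sum_image h1, Finset.sum_image h2,
    Finset.sum_add_distrib]
  simp

lemma mem_arcs {n : ℕ} {π : Finpartition (Finset.Icc 1 n)} {a : ℕ × ℕ} :
    a ∈ arcs π ↔ ∃ B ∈ π.parts, a.1 ∈ B ∧ a.2 ∈ B ∧ a.1 < a.2 ∧
      ∀ x ∈ B, ¬ (a.1 < x ∧ x < a.2) := by
  rw [arcs, Finset.mem_filter, and_iff_right_iff_imp]
  rintro ⟨B, hB, h1, h2, -⟩
  exact Finset.mem_product.mpr ⟨π.le hB h1, π.le hB h2⟩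

lemma mem_blockMaxima {n : ℕ} {π : Finpartition (Finset.Icc 1 n)} {m : ℕ} :
    m ∈ blockMaxima π ↔ ∃ B ∈ π.parts, m ∈ B ∧ ∀ x ∈ B, x ≤ m := by
  rw [blockMaxima, Finset.mem_filter, and_iff_right_iff_imp]
  rintro ⟨B, hB, h, -⟩
  exact π.le hB h

section AddTop

variable {n : ℕ} {π : Finpartition (Finset.Icc 1 n)} {B : Finset ℕ}

lemma le_of_mem_parts {C : Finset ℕ} (hC : C ∈ π.parts) {x : ℕ} (hx : x ∈ C) : x ≤ n :=
  (Finset.mem_Icc.mp (π.le hC hx)).2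

lemma arcs_addTop_empty (h : ∅ ∈ insert ∅ π.parts) : arcs (addTop π ∅ h) = arcs π := by
  ext a
  rw [mem_arcs, mem_arcs, addTop_parts, Finset.erase_eq_of_notMem π.empty_notMem_parts]
  simp only [Finset.mem_insert, exists_eq_or_imp, Finset.notMem_empty, or_false]
  refine or_iff_right ?_
  rintro ⟨h1, h2, h3, -⟩
  omega

lemma blockMaxima_addTop_empty (h : ∅ ∈ insert ∅ π.parts) :
    blockMaxima (addTop π ∅ h) = insert (n + 1) (blockMaxima π) := by
  ext m
  rw [Finset.mem_insert, mem_blockMaxima, mem_blockMaxima, addTop_parts,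
    Finset.erase_eq_of_notMem π.empty_notMem_parts]
  simp only [Finset.mem_insert, exists_eq_or_imp, Finset.notMem_empty, or_false, forall_eq]
  exact or_congr_left (and_iff_left_of_imp fun h => h.ge)

lemma arcs_addTop (hB : B ∈ insert ∅ π.parts) (hB' : B ∈ π.parts) {m : ℕ} (hm : m ∈ B)
    (hmax : ∀ x ∈ B, x ≤ m) : arcs (addTop π B hB) = insert (m, n + 1) (arcs π) := by
  have hmn := le_of_mem_parts hB' hm
  ext ⟨i, j⟩
  rw [Finset.mem_insert, mem_arcs, mem_arcs, addTop_parts]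
  simp only [Prod.mk.injEq]
  constructor
  · rintro ⟨C, hC, hi, hj, hij, h⟩
    rcases Finset.mem_insert.mp hC with rfl | hC
    · rcases Finset.mem_insert.mp hj with rfl | hj
      · have hiB : i ∈ B := (Finset.mem_insert.mp hi).resolve_left hij.ne
        have := hmax i hiB
        have := h m (Finset.mem_insert_of_mem hm)
        exact Or.inl ⟨by omega, rfl⟩
      · have := le_of_mem_parts hB' hj
        have hiB : i ∈ B := (Finset.mem_insert.mp hi).resolve_left (by omega)
        exact Or.inr ⟨B, hB', hiB, hj, hij, fun x hx => h x (Finset.mem_insert_of_mem hx)⟩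
    · exact Or.inr ⟨C, Finset.mem_of_mem_erase hC, hi, hj, hij, h⟩
  · rintro (⟨rfl, rfl⟩ | ⟨C, hC, hi, hj, hij, h⟩)
    · refine ⟨_, Finset.mem_insert_self _ _, Finset.mem_insert_of_mem hm,
        Finset.mem_insert_self _ _, by omega, fun x hx => ?_⟩
      rcases Finset.mem_insert.mp hx with rfl | hx
      · simp
      · have := hmax x hx
        omega
    · by_cases hCB : C = B
      · subst hCB
        refine ⟨_, Finset.mem_insert_self _ _, Finset.mem_insert_of_mem hi,
          Finset.mem_insert_of_mem hj, hij, fun x hx => ?_⟩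
        rcases Finset.mem_insert.mp hx with rfl | hx
        · have := le_of_mem_parts hC hj
          omega
        · exact h x hx
      · exact ⟨C, Finset.mem_insert_of_mem (Finset.mem_erase.mpr ⟨hCB, hC⟩), hi, hj, hij, h⟩

lemma blockMaxima_addTop (hB : B ∈ insert ∅ π.parts) (hB' : B ∈ π.parts) {m : ℕ} (hm : m ∈ B)
    (hmax : ∀ x ∈ B, x ≤ m) :
    blockMaxima (addTop π B hB) = insert (n + 1) ((blockMaxima π).erase m) := by
  ext i
  rw [Finset.mem_insert, Finset.mem_erase, mem_blockMaxima, mem_blockMaxima, addTop_parts]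
  constructor
  · rintro ⟨C, hC, hi, h⟩
    rcases Finset.mem_insert.mp hC with rfl | hC
    · have h1 := h (n + 1) (Finset.mem_insert_self _ _)
      refine Or.inl ((Finset.mem_insert.mp hi).resolve_right fun hi => ?_)
      have := le_of_mem_parts hB' hi
      omega
    · obtain ⟨hne, hC⟩ := Finset.mem_erase.mp hC
      refine Or.inr ⟨?_, C, hC, hi, h⟩
      rintro rfl
      exact hne (π.eq_of_mem_parts hC hB' hi hm)
  · rintro (rfl | ⟨him, C, hC, hi, h⟩)
    · refine ⟨_, Finset.mem_insert_self _ _, Finset.mem_insert_self _ _, fun x hx => ?_⟩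
      rcases Finset.mem_insert.mp hx with rfl | hx
      · exact le_rfl
      · have := le_of_mem_parts hB' hx
        omega
    · refine ⟨C, Finset.mem_insert_of_mem (Finset.mem_erase.mpr ⟨?_, hC⟩), hi, h⟩
      rintro rfl
      exact him (le_antisymm (hmax i hi) (h m hm))

lemma arcs_snd_le {a : ℕ × ℕ} (ha : a ∈ arcs π) : a.2 ≤ n := by
  obtain ⟨C, hC, -, h, -⟩ := mem_arcs.mp ha
  exact le_of_mem_parts hC h

lemma blockMaxima_le {m : ℕ} (h : m ∈ blockMaxima π) : m ≤ n := by
  obtain ⟨C, hC, h, -⟩ := mem_blockMaxima.mp h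
  exact le_of_mem_parts hC h

lemma top_notMem_blockMaxima : n + 1 ∉ blockMaxima π := fun h => by
  have := blockMaxima_le h
  omega

/-- The only new arc is infinite and starts right of the end of every finite arc. -/
lemma croStar_addTop_empty (h : ∅ ∈ insert ∅ π.parts) :
    croStar (addTop π ∅ h) = croStar π := by
  rw [croStar_eq_sum, croStar_eq_sum, arcs_addTop_empty, blockMaxima_addTop_empty]
  congr 1
  refine Finset.sum_congr rfl fun a ha => ?_
  have := arcs_snd_le ha
  rw [Finset.sum_insert top_notMem_blockMaxima, if_neg (by omega), zero_add]

lemma croStar_addTop (hB : B ∈ insert ∅ π.parts) (hB' : B ∈ π.parts) {m : ℕ} (hm : m ∈ B)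
    (hmax : ∀ x ∈ B, x ≤ m) :
    croStar (addTop π B hB) =
      croStar π + ((blockMaxima π).filter fun x => m < x).card := by
  have hnot : (m, n + 1) ∉ arcs π := fun h => by
    have := arcs_snd_le h
    simp only at this
    omega
  have hmM : m ∈ blockMaxima π := mem_blockMaxima.mpr ⟨B, hB', hm, hmax⟩
  have hnM : n + 1 ∉ (blockMaxima π).erase m := fun h =>
    top_notMem_blockMaxima (Finset.mem_of_mem_erase h)
  have e1 : ∀ b ∈ arcs π, (if m < b.1 ∧ b.1 < n + 1 ∧ n + 1 < b.2 then 1 else 0) = 0 := by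
    intro b hb
    have := arcs_snd_le hb
    exact if_neg (by omega)
  -- The crossings of `(m, n + 1)` with finite arcs are those that the former infinite arc at `m`
  -- had.
  have e2 : ∀ a ∈ arcs π, (if a.1 < m ∧ m < a.2 ∧ a.2 < n + 1 then 1 else 0) =
      if a.1 < m ∧ m < a.2 then 1 else 0 := by
    intro a ha
    have := arcs_snd_le ha
    exact if_congr (by omega) rfl rfl
  have e3 : ∀ a ∈ arcs π, (if a.1 < n + 1 ∧ n + 1 < a.2 then 1 else 0) = 0 := by
    intro a ha
    have := arcs_snd_le ha
    exact if_neg (by omega)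
  have e4 : ∀ a : ℕ × ℕ, (∑ x ∈ blockMaxima π, if a.1 < x ∧ x < a.2 then 1 else 0) =
      (if a.1 < m ∧ m < a.2 then 1 else 0) +
        ∑ x ∈ (blockMaxima π).erase m, if a.1 < x ∧ x < a.2 then 1 else 0 := fun a =>
    (Finset.add_sum_erase _ _ hmM).symm
  -- The net gain: `(m, n + 1)` meets the infinite arcs that start right of `m`.
  have e5 : (∑ x ∈ (blockMaxima π).erase m, if m < x ∧ x < n + 1 then 1 else 0) =
      ((blockMaxima π).filter fun x => m < x).card := by
    rw [Finset.card_filter, ← Finset.add_sum_erase _ _ hmM, if_neg (lt_irrefl m), zero_add]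
    refine Finset.sum_congr rfl fun x hx => if_congr ?_ rfl rfl
    have := blockMaxima_le (Finset.mem_of_mem_erase hx)
    omega
  rw [croStar_eq_sum, croStar_eq_sum, arcs_addTop hB hB' hm hmax,
    blockMaxima_addTop hB hB' hm hmax]
  simp only [Finset.sum_insert hnot, Finset.sum_insert hnM, Finset.sum_add_distrib, e4, e5]
  rw [Finset.sum_congr rfl e1, Finset.sum_congr rfl e2, Finset.sum_congr rfl e3]
  simp only [lt_irrefl, and_false, if_false, Finset.sum_const_zero]
  omega

end AddTop

lemma sum_parts_eq_sum_blockMaxima {R : Type*} [AddCommMonoid R] {n : ℕ}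
    (π : Finpartition (Finset.Icc 1 n)) (f : ℕ → R) :
    ∑ B ∈ π.parts, f (B.sup id) = ∑ m ∈ blockMaxima π, f m := by
  have hsup : ∀ B ∈ π.parts, B.sup id ∈ B := fun B hB => by
    obtain ⟨m, hm, h⟩ := Finset.exists_mem_eq_sup B (π.nonempty_of_mem_parts hB) id
    rw [h]
    exact hm
  refine Finset.sum_bij (fun B _ => B.sup id) ?_ ?_ ?_ fun _ _ => rfl
  · exact fun B hB => mem_blockMaxima.mpr ⟨B, hB, hsup B hB, fun x hx => Finset.le_sup (f := id) hx⟩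
  · exact fun B hB C hC h => π.eq_of_mem_parts hB hC (hsup B hB) (h ▸ hsup C hC)
  · intro m hm
    obtain ⟨B, hB, hmB, h⟩ := mem_blockMaxima.mp hm
    exact ⟨B, hB, le_antisymm (Finset.sup_le h) (Finset.le_sup (f := id) hmB)⟩

lemma card_blockMaxima {n : ℕ} (π : Finpartition (Finset.Icc 1 n)) :
    (blockMaxima π).card = π.parts.card := by
  rw [Finset.card_eq_sum_ones, Finset.card_eq_sum_ones]
  exact (sum_parts_eq_sum_blockMaxima π fun _ => 1).symm

/-! ### The recurrence for the generating polynomial, and its comparison with the alternating sum.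
-/

/-- The generating polynomial of `croStar` over the partitions of `{1, …, n}` into `k` blocks. -/
def croStarSum {K : Type*} [Field K] (q : K) (n k : ℕ) : K :=
  ∑ π : Finpartition (Finset.Icc 1 n), if π.parts.card = k then q ^ croStar π else 0

section Recurrence

variable {K : Type*} [Field K] (q : K)

/-- The first sum collects the partitions where `n + 1` is a singleton. Otherwise the block joined
is recorded by its maximum, and the gains in crossings sum to [k]_q by `sum_pow_card_filter_gt`. -/
lemma croStarSum_succ (n k : ℕ) :
    croStarSum q (n + 1) k =
      (∑ π : Finpartition (Finset.Icc 1 n), if π.parts.card + 1 = k then q ^ croStar π else 0) +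
        qInt q k * croStarSum q n k := by
  rw [croStarSum, croStarSum, Finset.mul_sum, ← Finset.sum_add_distrib,
    sum_finpartition_succ _ fun π B =>
      if B = ∅ then (if π.parts.card + 1 = k then q ^ croStar π else 0)
      else if π.parts.card = k then
        q ^ croStar π * q ^ ((blockMaxima π).filter fun x => B.sup id < x).card else 0]
  · refine Finset.sum_congr rfl fun π _ => ?_
    rw [if_pos rfl]
    congr 1
    rw [Finset.sum_congr rfl fun B hB => if_neg (π.ne_empty hB)]
    split_ifs with h
    · rw [← Finset.mul_sum, sum_parts_eq_sum_blockMaxima π fun m =>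
        q ^ ((blockMaxima π).filter fun x => m < x).card, sum_pow_card_filter_gt,
        card_blockMaxima, h, qInt, mul_comm]
    · simp
  · intro π B hB
    by_cases h : B = ∅
    · subst h
      rw [if_pos rfl, card_addTop_empty_parts, croStar_addTop_empty]
    · have hB' := (Finset.mem_insert.mp hB).resolve_left h
      obtain ⟨m, hm, hsup⟩ := Finset.exists_mem_eq_sup B (Finset.nonempty_iff_ne_empty.mpr h) id
      have hsup' : B.sup id = m := hsup
      rw [if_neg h, card_addTop_parts_of_mem hB hB', croStar_addTop hB hB' hm
        fun x hx => hsup' ▸ Finset.le_sup (f := id) hx, hsup', pow_add]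

lemma croStarSum_succ_zero (n : ℕ) : croStarSum q (n + 1) 0 = 0 := by
  simp [croStarSum_succ, qInt]

lemma croStarSum_succ_succ (n k : ℕ) :
    croStarSum q (n + 1) (k + 1) =
      croStarSum q n k + qInt q (k + 1) * croStarSum q n (k + 1) := by
  rw [croStarSum_succ]
  simp [croStarSum]

lemma croStarSum_zero (k : ℕ) : croStarSum q 0 k = if k = 0 then 1 else 0 := by
  have hparts : ∀ π : Finpartition (Finset.Icc 1 0), π.parts = ∅ := fun π =>
    π.parts_eq_empty_iff.mpr rfl
  have hcro : ∀ π : Finpartition (Finset.Icc 1 0), croStar π = 0 := by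
    intro π
    simp [croStar_eq_sum, arcs]
  have huniq : Fintype.card (Finpartition (Finset.Icc 1 0)) = 1 :=
    Fintype.card_eq_one_iff.mpr ⟨⊥, fun π => Finpartition.ext (by rw [hparts, hparts])⟩
  simp only [croStarSum, hparts, hcro, Finset.card_empty, pow_zero, Finset.sum_const,
    Finset.card_univ, huniq, one_smul, eq_comm]

lemma croStarSum_eq_zero_of_lt {n k : ℕ} (h : n < k) : croStarSum q n k = 0 := by
  induction n generalizing k with
  | zero => rw [croStarSum_zero, if_neg (by omega)]
  | succ n ih =>
    obtain ⟨k, rfl⟩ : ∃ l, k = l + 1 := ⟨k - 1, by omega⟩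
    rw [croStarSum_succ_succ, ih (by omega), ih (by omega), mul_zero, add_zero]

lemma one_sub_pow_mul_croStarSum (n k : ℕ) :
    (1 - q) ^ (n - k) * croStarSum q n k = altSum q n k := by
  induction n generalizing k with
  | zero =>
    rw [croStarSum_zero]
    cases k <;> simp [altSum, gaussBinom_zero_left]
  | succ n ih =>
    cases k with
    | zero => rw [croStarSum_succ_zero, altSum_succ_zero, mul_zero]
    | succ k =>
      rw [croStarSum_succ_succ, altSum_succ_succ, ← ih k, ← ih (k + 1), Nat.add_sub_add_right,
        ← one_sub_mul_qInt]
      -- For `k < n` the exponents `n - k` and `n - (k + 1)` differ by one, which supplies the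
      -- factor `1 - q`. For `k ≥ n` truncated subtraction makes them equal, but then the term with
      -- `k + 1` blocks is zero.
      rcases lt_or_ge k n with h | h
      · rw [show n - k = (n - (k + 1)) + 1 by omega, pow_succ]
        ring
      · rw [croStarSum_eq_zero_of_lt q (n := n) (k := k + 1) (by omega)]
        ring

end Recurrence

end SetPartition

theorem theorem3 {K : Type*} [Field K] (q : K) (n k : ℕ)
    (hq : ∀ i : ℕ, 1 ≤ i → i ≤ n → q ^ i ≠ 1) :
    ∑ π : Finpartition (Finset.Icc 1 n) with π.parts.card = k, q ^ SetPartition.croStar π =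
      1 / (1 - q) ^ (n - k) *
        ∑ j ∈ Finset.range (n + 1 - k),
          (-1) ^ j * (n.choose (k + j) : K) * qBinom q (k + j) j := by
  have hne : (1 - q) ^ (n - k) ≠ 0 := by
    -- For `n = 0` the hypothesis allows `q = 1`, but the exponent is then `0`.
    rcases Nat.eq_zero_or_pos n with rfl | hn
    · simp
    · exact pow_ne_zero _ (sub_ne_zero.mpr fun h => hq 1 le_rfl hn (by rw [pow_one, ← h]))
  have hsum : ∑ j ∈ Finset.range (n + 1 - k),
      (-1) ^ j * (n.choose (k + j) : K) * qBinom q (k + j) j = altSum q n k := by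
    rw [altSum_eq_of_le q (N := n + 1 - k) (by omega)]
    refine Finset.sum_congr rfl fun j hj => ?_
    rw [Finset.mem_range] at hj
    rw [qBinom_eq_gaussBinom q fun i h1 h2 => hq i h1 (by omega)]
  rw [hsum, ← SetPartition.one_sub_pow_mul_croStarSum, one_div, inv_mul_cancel_left₀ hne,
    Finset.sum_filter, SetPartition.croStarSum]
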